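/- Let $\mathcal X$ be a finite set with a probability measure $\mathrm P$ (defined on all subsets) and let $\mathcal R\subseteq 2^{\mathcal X}$ be a family of ranges. The VC-dimension of $(\mathcal X,\mathcal R)$ is the maximal size of a set $Y\subseteq\mathcal X$ with $\{R\cap Y: R\in\mathcal R\}=2^Y$ (and $0$ if $\mathcal R=\emptyset$). For $\epsilon>0$, an $\epsilon$-net is a set $S\subseteq \operatorname{supp}(\mathrm P)=\{x:\mathrm P(\{x\})>0\}$ that intersects every $R\in\mathcal R$ with $\mathrm P(R)\ge\epsilon$. Put $\mathcal R_{\le\delta}:=\{R\in\mathcal R:\mathrm P(R)\le\delta\}$. Alexander's capacity of $(\mathcal X,\mathcal R)$ is $$\tau(\epsilon):=\max\Big\{1,\ \sup_{\delta\ge\epsilon}\frac{\mathrm P\big(\bigcup_{R\in\mathcal R_{\le\delta}}R\big)}{\delta}\Big\}.$$ The doubling constant of $(\mathcal X,\mathcal R)$ at $\epsilon$ is $\sup_{\delta\ge\epsilon}\mathcal M(\mathcal R_{\le2\delta},\delta)$, where $\mathcal M(\mathcal F,\delta)$ is the largest size of a family $\mathcal Q\subseteq\mathcal F$ such that $\mathrm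 P(A\,\Delta\,B)\ge\delta$ for all distinct $A,B\in\mathcal Q$. There is an absolute constant $C>0$ such that the following holds for every such $(\mathcal X,\mathcal R)$ and $\mathrm P$, of VC-dimension $d$, every $\epsilon>0$, and every real number $D_\epsilon$ that is at least the doubling constant of $(\mathcal X,\mathcal R)$ at $\epsilon$. 1. If $D_\epsilon\ge e/\epsilon$, then there is an $\epsilon$-net for $(\mathcal X,\mathcal R)$ of size at most $$C\,\frac1\epsilon\big(d+\log(\epsilon D_\epsilon)\big).$$ 2. If $D_\epsilon\ge2\tau(\epsilon)$, then there is an $\epsilon$-net for $(\mathcal X,\mathcal R)$ of size at most $$C\,\tau(\epsilon)\Big(d+\log\frac{D_\epsilon}{\tau(\epsilon)}\Big)\max\Big\{1,\log\frac1\epsilon\Big\}.$$ -/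

import Mathlib

open MeasureTheory

noncomputable section

namespace RangeSpace

variable {X : Type*} [MeasurableSpace X]

/-- `S` is an `ε`-net for the range space with ranges `ℛ` and measure `P` on a finite ground set:
`S` lies in the support of `P` (the points of positive mass) and meets every range of
measure at least `ε`. -/
def IsNet (P : Measure X) (ℛ : Finset (Finset X)) (ε : ℝ) (S : Finset X) : Prop :=
  (∀ x ∈ S, 0 < P.real {x}) ∧
    ∀ R ∈ ℛ, ε ≤ P.real (R : Set X) → ∃ x ∈ S, x ∈ R

/-- The ranges of measure at most `δ`. -/
def lightRanges (P : Measure X) (ℛ : Finset (Finset X)) (δ : ℝ) : Finset (Finset X) :=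
  {R ∈ ℛ | P.real (R : Set X) ≤ δ}

/-- Alexander's capacity, truncated from below at `1`:
`max 1 (sup_{δ ≥ ε} P(⋃ {R ∈ ℛ : P R ≤ δ}) / δ)`. -/
def capacity (P : Measure X) (ℛ : Finset (Finset X)) (ε : ℝ) : ℝ :=
  max 1 (⨆ δ : Set.Ici ε, P.real (⋃ R ∈ lightRanges P ℛ δ, (R : Set X)) / (δ : ℝ))

/-- The distance `ρ(A, B) = P(A ∆ B)` between ranges. -/
def symmDist (P : Measure X) (A B : Finset X) : ℝ :=
  P.real (symmDiff (A : Set X) (B : Set X))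

/-- Distinct members of `𝒬` are at distance at least `δ` from each other. -/
def IsPacking (P : Measure X) (δ : ℝ) (𝒬 : Finset (Finset X)) : Prop :=
  ∀ A ∈ 𝒬, ∀ B ∈ 𝒬, A ≠ B → δ ≤ symmDist P A B

open scoped Classical in
/-- The packing number of `ℱ`: the largest size of a `δ`-packing contained in `ℱ`. -/
def packingNumber (P : Measure X) (ℱ : Finset (Finset X)) (δ : ℝ) : ℕ :=
  {𝒬 ∈ ℱ.powerset | IsPacking P δ 𝒬}.sup Finset.card

/-- The doubling constant: the supremum over `δ ≥ ε` of the packing number, at scale `δ`, of the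
family of ranges of measure at most `2 δ`. -/
def doublingConstant (P : Measure X) (ℛ : Finset (Finset X)) (ε : ℝ) : ℕ :=
  ⨆ δ : Set.Ici ε, packingNumber P (lightRanges P ℛ (2 * (δ : ℝ))) δ

/-- The supremum in `capacity` is that of a bounded set. -/
theorem bddAbove_capacity (P : Measure X) [IsProbabilityMeasure P] (ℛ : Finset (Finset X))
    {ε : ℝ} (hε : 0 < ε) :
    BddAbove (Set.range fun δ : Set.Ici ε =>
      P.real (⋃ R ∈ lightRanges P ℛ δ, (R : Set X)) / (δ : ℝ)) := by
  refine ⟨1 / ε, ?_⟩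
  rintro _ ⟨⟨δ, hδ⟩, rfl⟩
  exact div_le_div₀ zero_le_one measureReal_le_one hε hδ

open scoped Classical in
/-- The supremum in `doublingConstant` is that of a bounded set. -/
theorem bddAbove_doublingConstant (P : Measure X) (ℛ : Finset (Finset X)) (ε : ℝ) :
    BddAbove (Set.range fun δ : Set.Ici ε =>
      packingNumber P (lightRanges P ℛ (2 * (δ : ℝ))) δ) := by
  refine ⟨ℛ.card, ?_⟩
  rintro _ ⟨δ, rfl⟩
  refine Finset.sup_le fun 𝒬 h𝒬 => Finset.card_le_card ?_
  exact (Finset.mem_powerset.1 (Finset.mem_filter.1 h𝒬).1).trans (Finset.filter_subset _ _)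

end RangeSpace

end

/-! Split the ranges into dyadic layers of measure between δ and 2δ, where δ = 2^i ε. A maximal
δ-packing of a layer has at most D members, and every range of the layer fills at least half of some
member Q (`exists_layer_cover`). So it suffices to hit the ranges that fill half of one of D sets.

Sample m points from a set U containing the layer's ranges, in which each Q has relative weight at
least η. Call Q failed if some range filling half of it is missed; double sampling bounds the
probability of this by 16^d exp(-ηm/8) (`missing_le`). With m of order (d + L)/η and e^L ≥ ηD, at
most e^(-d)/η sets fail on average. Each is repaired by a net of 24d + 1 points (`exists_half_net`),
which adds only O(1/η) points (`exists_hitting_set`). Repairing instead of taking a union bound is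
what gives log(ηD) rather than log D.

Taking U to be the whole space gives η = δ, and the costs of the layers sum geometrically. Taking U
to be the union of the ranges of measure at most 2δ gives η = 1/(2τ) in each of O(max(1, log(1/ε)))
layers. -/

open MeasureTheory

noncomputable section

namespace RangeSpace

open Finset

/-! ### Double sampling and hitting sets -/

section Sampling

variable {X : Type*} [DecidableEq X]

/-- The traces left on a tuple of points `z` by the ranges restricted to `Q`. -/
def traces {ι : Type*} [Fintype ι] [DecidableEq ι] (ℛ : Finset (Finset X)) (Q : Finset X)
    (z : ι → X) : Finset (Finset ι) :=
  ℛ.image fun R => univ.filter fun i => z i ∈ R ∩ Q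

/-- Shattering realises the full pattern, which puts every `z i` in `Q`, and separates any two
indices, so `z` is injective on `T`. The image of `T` is then shattered by `ℛ` itself. -/
theorem shatters_traces {ι : Type*} [Fintype ι] [DecidableEq ι] {ℛ : Finset (Finset X)}
    {Q : Finset X} {z : ι → X} {T : Finset ι} (hT : (traces ℛ Q z).Shatters T) :
    (∀ i ∈ T, z i ∈ Q) ∧ T.card ≤ ℛ.vcDim := by
  have key : ∀ U ⊆ T, ∃ R ∈ ℛ, ∀ i ∈ T, (z i ∈ R ∩ Q ↔ i ∈ U) := by
    intro U hU
    obtain ⟨A, hA, hAU⟩ := hT hU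
    obtain ⟨R, hR, rfl⟩ := mem_image.1 hA
    refine ⟨R, hR, fun i hi => ?_⟩
    rw [← hAU]
    simp [hi]
  have hQ : ∀ i ∈ T, z i ∈ Q := by
    intro i hi
    obtain ⟨R, _, h⟩ := key T Subset.rfl
    exact (mem_inter.1 ((h i hi).2 hi)).2
  refine ⟨hQ, ?_⟩
  have hinj : Set.InjOn z T := by
    intro i hi j hj hij
    obtain ⟨R, _, h⟩ := key {i} (singleton_subset_iff.2 hi)
    have h1 := (h i hi).2 (mem_singleton_self i)
    rw [hij] at h1
    exact (mem_singleton.1 ((h j hj).1 h1)).symm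
  rw [← card_image_of_injOn hinj]
  refine Shatters.card_le_vcDim fun V hV => ?_
  obtain ⟨R, hR, h⟩ := key {i ∈ T | z i ∈ V} (filter_subset _ _)
  refine ⟨R, hR, ?_⟩
  ext x
  constructor
  · intro hx
    obtain ⟨hx1, hx2⟩ := mem_inter.1 hx
    obtain ⟨i, hi, rfl⟩ := mem_image.1 hx1
    exact (mem_filter.1 ((h i hi).1 (mem_inter.2 ⟨hx2, hQ i hi⟩))).2
  · intro hx
    obtain ⟨i, hi, rfl⟩ := mem_image.1 (hV hx)
    exact mem_inter.2 ⟨hV hx, (mem_inter.1 ((h i hi).2 (mem_filter.2 ⟨hi, hx⟩))).1⟩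

/-- A generating-function form of the Sauer–Shelah bound on the number of traces. -/
theorem card_traces_le {ι : Type*} [Fintype ι] [DecidableEq ι] {ℛ : Finset (Finset X)} {d : ℕ}
    (hd : ℛ.vcDim ≤ d) (Q : Finset X) (z : ι → X) :
    ((traces ℛ Q z).card : ℝ) ≤ 16 ^ d * ∏ i, (1 + if z i ∈ Q then (1 / 16 : ℝ) else 0) := by
  have h1 : ((traces ℛ Q z).card : ℝ) ≤ ((traces ℛ Q z).shatterer.card : ℝ) := by
    exact_mod_cast card_le_card_shatterer _
  refine h1.trans ?_
  rw [prod_one_add, mul_sum, card_eq_sum_ones, Nat.cast_sum]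
  refine (sum_le_sum fun T hT => ?_).trans
    (sum_le_sum_of_subset_of_nonneg (fun T _ => mem_powerset.2 (subset_univ T)) ?_)
  -- A shattered `T` contributes 16^d · 16^(-|T|) ≥ 1 to the expanded product.
  · obtain ⟨h2, h3⟩ := shatters_traces (mem_shatterer.1 hT)
    rw [prod_congr rfl fun i hi => if_pos (h2 i hi), prod_const, Nat.cast_one, one_div, inv_pow,
      ← div_eq_mul_inv, one_le_div (by positivity)]
    exact pow_le_pow_right₀ (by norm_num) (h3.trans hd)
  · intro T _ _
    exact mul_nonneg (by positivity) (prod_nonneg fun i _ => by split_ifs <;> norm_num)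

/-- The weight, at the swap `σ`, of a set `T` that has to avoid the first half of a double sample:
two to the power of the number of its points in the second half. -/
def swapWeight {m : ℕ} (T : Finset (Fin m × Bool)) (σ : Fin m → Bool) : ℝ :=
  ∏ i, (if (i, σ i) ∈ T then 0 else if (i, !σ i) ∈ T then 2 else 1)

theorem swapWeight_nonneg {m : ℕ} (T : Finset (Fin m × Bool)) (σ : Fin m → Bool) :
    0 ≤ swapWeight T σ :=
  prod_nonneg fun i _ => by split_ifs <;> norm_num

/-- The sum factorises over the pairs: one contributes 0 + 2, 1 + 1 or 0 + 0 according as one, none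
or both of its points lie in `T`. -/
theorem sum_swapWeight_le {m : ℕ} (T : Finset (Fin m × Bool)) :
    ∑ σ, swapWeight T σ ≤ 2 ^ m := by
  unfold swapWeight
  rw [← Fintype.prod_sum
    (fun (i : Fin m) (b : Bool) => if (i, b) ∈ T then (0 : ℝ) else if (i, !b) ∈ T then 2 else 1)]
  calc _ ≤ ∏ _i : Fin m, (2 : ℝ) := by
        refine prod_le_prod (fun i _ => sum_nonneg fun b _ => ?_) fun i _ => ?_
        · split_ifs <;> norm_num
        · rw [Fintype.sum_bool]
          simp only [Bool.not_true, Bool.not_false]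
          split_ifs <;> norm_num
    _ = 2 ^ m := by simp

/-- Splitting a double sample into the half selected by `σ` and the other half. -/
def splitEquiv {m : ℕ} (σ : Fin m → Bool) :
    (Fin m × Bool → X) ≃ (Fin m → X) × (Fin m → X) where
  toFun z := (fun i => z (i, σ i), fun i => z (i, !σ i))
  invFun p := fun ib => if ib.2 = σ ib.1 then p.1 ib.1 else p.2 ib.1
  left_inv z := by
    funext ⟨i, b⟩
    by_cases h : b = σ i
    · simp [h]
    · have : (!σ i) = b := by cases b <;> cases hs : σ i <;> simp_all
      simp [h, this]
  right_inv p := by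
    ext i <;> simp

theorem sum_prod_tuple {Y ι : Type*} [Fintype Y] [Fintype ι] [DecidableEq ι] (φ : Y → ℝ) :
    ∑ z : ι → Y, ∏ i, φ (z i) = (∑ x, φ x) ^ Fintype.card ι := by
  rw [← Fintype.prod_sum (fun (_ : ι) x => φ x)]
  simp

/-- The sample `f` misses some range that takes up at least half of `Q`. -/
def Misses {m : ℕ} (w : X → ℝ) (ℛ : Finset (Finset X)) (Q : Finset X) (f : Fin m → X) : Prop :=
  ∃ R ∈ ℛ, (∑ x ∈ Q, w x) / 2 ≤ ∑ x ∈ R ∩ Q, w x ∧ ∀ i, f i ∉ R ∩ Q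

open scoped Classical in
-- If `f` misses `R`, draw a second sample `g`. The swap weight of the trace of `R` is 2 to the
-- number of points of `g` in `R ∩ Q`; its mean is the m-th power of 1 plus the weight of `R ∩ Q`.
-- This weight replaces the usual requirement that `g` hit `R` often.
theorem missing_mul_le [Fintype X] {w : X → ℝ} (hw : ∀ x, 0 ≤ w x) (hw1 : ∑ x, w x = 1)
    (ℛ : Finset (Finset X)) (Q : Finset X) {m : ℕ} (σ : Fin m → Bool) :
    (∑ f : Fin m → X, if Misses w ℛ Q f then ∏ i, w (f i) else 0) *
        (1 + (∑ x ∈ Q, w x) / 2) ^ m ≤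
      ∑ z : Fin m × Bool → X, (∏ i, w (z i)) * ∑ T ∈ traces ℛ Q z, swapWeight T σ := by
  have hsplit : ∀ p : (Fin m → X) × (Fin m → X),
      ∏ i, w ((splitEquiv σ).symm p i) = (∏ i, w (p.1 i)) * ∏ i, w (p.2 i) := by
    intro p
    rw [Fintype.prod_prod_type, ← prod_mul_distrib]
    refine prod_congr rfl fun i _ => ?_
    rw [Fintype.prod_bool]
    cases hs : σ i <;> simp [splitEquiv, hs, mul_comm]
  rw [← (splitEquiv σ).symm.sum_comp, Fintype.sum_prod_type, sum_mul]
  refine sum_le_sum fun f _ => ?_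
  have hprod : ∀ g : Fin m → X, 0 ≤ ∏ i, w (g i) := fun g => prod_nonneg fun i _ => hw _
  split_ifs with hf
  · obtain ⟨R, hR, hRQ, hmiss⟩ := hf
    simp only [hsplit, mul_assoc]
    rw [← mul_sum]
    refine mul_le_mul_of_nonneg_left ?_ (hprod f)
    have hterm : ∀ g : Fin m → X, ∏ i, (w (g i) * (1 + if g i ∈ R ∩ Q then 1 else 0)) ≤
        (∏ i, w (g i)) * ∑ T ∈ traces ℛ Q ((splitEquiv σ).symm (f, g)), swapWeight T σ := by
      intro g
      rw [prod_mul_distrib]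
      refine mul_le_mul_of_nonneg_left ?_ (hprod g)
      have hmem : (univ.filter fun i => (splitEquiv σ).symm (f, g) i ∈ R ∩ Q) ∈
          traces ℛ Q ((splitEquiv σ).symm (f, g)) := mem_image_of_mem _ hR
      refine le_trans (le_of_eq ?_)
        (single_le_sum (f := fun T => swapWeight T σ) (fun T _ => swapWeight_nonneg T σ) hmem)
      refine prod_congr rfl fun i _ => ?_
      have h1 : (splitEquiv σ).symm (f, g) (i, σ i) = f i := by simp [splitEquiv]
      have h2 : (splitEquiv σ).symm (f, g) (i, !σ i) = g i := by simp [splitEquiv]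
      simp only [mem_filter, mem_univ, true_and, h1, h2, hmiss i, if_false]
      split_ifs <;> norm_num
    refine le_trans ?_ (sum_le_sum fun g _ => hterm g)
    rw [sum_prod_tuple (fun x => w x * (1 + if x ∈ R ∩ Q then 1 else 0)), Fintype.card_fin]
    have hQ : 0 ≤ ∑ x ∈ Q, w x := sum_nonneg fun x _ => hw x
    refine pow_le_pow_left₀ (by positivity) ?_ m
    simp only [mul_add, mul_one, sum_add_distrib, hw1, mul_ite, mul_zero]
    rw [← sum_filter, filter_mem_eq_inter, univ_inter]
    linarith
  · rw [zero_mul]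
    refine sum_nonneg fun g _ => mul_nonneg (prod_nonneg fun i _ => hw _)
      (sum_nonneg fun T _ => swapWeight_nonneg T σ)

open scoped Classical in
/-- Double sampling: an i.i.d. sample of size `m` misses a range occupying at least half of `Q`
with probability exponentially small in `m` times the weight of `Q`. -/
theorem missing_le [Fintype X] {w : X → ℝ} (hw : ∀ x, 0 ≤ w x) (hw1 : ∑ x, w x = 1)
    {ℛ : Finset (Finset X)} {d : ℕ} (hd : ℛ.vcDim ≤ d) (Q : Finset X) (m : ℕ) :
    (∑ f : Fin m → X, if Misses w ℛ Q f then ∏ i, w (f i) else 0) ≤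
      16 ^ d * Real.exp (-((∑ x ∈ Q, w x) * m / 8)) := by
  set q := ∑ x ∈ Q, w x with hq
  set A := ∑ f : Fin m → X, if Misses w ℛ Q f then ∏ i, w (f i) else 0 with hA
  have hq0 : 0 ≤ q := sum_nonneg fun x _ => hw x
  have hq1 : q ≤ 1 := hw1 ▸ sum_le_sum_of_subset_of_nonneg (subset_univ _) fun x _ _ => hw x
  have h1 : 2 ^ m * (A * (1 + q / 2) ^ m) ≤ 2 ^ m * (16 ^ d * (1 + q / 16) ^ (2 * m)) := by
    calc 2 ^ m * (A * (1 + q / 2) ^ m)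
        = ∑ _σ : Fin m → Bool, A * (1 + q / 2) ^ m := by simp
      _ ≤ ∑ σ : Fin m → Bool, ∑ z : Fin m × Bool → X, (∏ i, w (z i)) *
            ∑ T ∈ traces ℛ Q z, swapWeight T σ :=
          sum_le_sum fun σ _ => missing_mul_le hw hw1 ℛ Q σ
      _ = ∑ z : Fin m × Bool → X, (∏ i, w (z i)) *
            ∑ T ∈ traces ℛ Q z, ∑ σ : Fin m → Bool, swapWeight T σ := by
          rw [sum_comm]
          refine sum_congr rfl fun z _ => ?_
          rw [← mul_sum, sum_comm]
      _ ≤ ∑ z : Fin m × Bool → X, (∏ i, w (z i)) *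
            (2 ^ m * (16 ^ d * ∏ i, (1 + if z i ∈ Q then (1 / 16 : ℝ) else 0))) := by
          refine sum_le_sum fun z _ => mul_le_mul_of_nonneg_left ?_ (prod_nonneg fun i _ => hw _)
          refine (sum_le_sum fun T _ => sum_swapWeight_le T).trans ?_
          rw [sum_const, nsmul_eq_mul, mul_comm]
          exact mul_le_mul_of_nonneg_left (card_traces_le hd Q z) (by positivity)
      _ = 2 ^ m * (16 ^ d * ∑ z : Fin m × Bool → X,
            ∏ i, (w (z i) * (1 + if z i ∈ Q then (1 / 16 : ℝ) else 0))) := by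
          rw [mul_sum, mul_sum]
          refine sum_congr rfl fun z _ => ?_
          rw [prod_mul_distrib]
          ring
      _ = 2 ^ m * (16 ^ d * (1 + q / 16) ^ (2 * m)) := by
          rw [sum_prod_tuple (fun x => w x * (1 + if x ∈ Q then (1 / 16 : ℝ) else 0)),
            Fintype.card_prod, Fintype.card_fin, Fintype.card_bool, mul_comm m 2]
          simp only [mul_add, mul_one, sum_add_distrib, hw1, mul_ite, mul_zero]
          rw [← sum_filter, filter_mem_eq_inter, univ_inter, ← sum_mul, ← hq, mul_one_div]
  have h2 : A * (1 + q / 2) ^ m ≤ 16 ^ d * (1 + q / 16) ^ (2 * m) :=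
    le_of_mul_le_mul_left h1 (by positivity)
  -- For q ≤ 1, (1 + q/16)² ≤ (1 - q/8)(1 + q/2): the 1/16 in the trace bound is small enough to
  -- leave a decay rate of q/8.
  have h3 : (1 + q / 16) ^ (2 * m) ≤ (1 - q / 8) ^ m * (1 + q / 2) ^ m := by
    rw [pow_mul, ← mul_pow]
    exact pow_le_pow_left₀ (by positivity) (by nlinarith) m
  have h4 : A ≤ 16 ^ d * (1 - q / 8) ^ m := by
    refine le_of_mul_le_mul_right (a := (1 + q / 2) ^ m) ?_ (by positivity)
    rw [mul_assoc]
    exact h2.trans (mul_le_mul_of_nonneg_left h3 (by positivity))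
  refine h4.trans (mul_le_mul_of_nonneg_left ?_ (by positivity))
  calc (1 - q / 8) ^ m ≤ Real.exp (-(q / 8)) ^ m :=
        pow_le_pow_left₀ (by linarith) (Real.one_sub_le_exp_neg _) m
    _ = Real.exp (-(q * m / 8)) := by rw [← Real.exp_nat_mul]; ring_nf

theorem pos_of_prod_pos {Y : Type*} {w : Y → ℝ} (hw : ∀ x, 0 ≤ w x) {m : ℕ} {f : Fin m → Y}
    (hf : 0 < ∏ i, w (f i)) (i : Fin m) : 0 < w (f i) :=
  (hw _).lt_of_ne fun h => hf.ne' (prod_eq_zero (mem_univ i) h.symm)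

theorem sixteen_pow_le_exp (d : ℕ) : (16 : ℝ) ^ d ≤ Real.exp (3 * d) := by
  have h : (16 : ℝ) ≤ Real.exp 3 := by
    have h1 : (2.7 : ℝ) ≤ Real.exp 1 := by linarith [Real.exp_one_gt_d9]
    calc (16 : ℝ) ≤ 2.7 ^ 3 := by norm_num
      _ ≤ Real.exp 1 ^ 3 := pow_le_pow_left₀ (by norm_num) h1 3
      _ = Real.exp 3 := by rw [← Real.exp_nat_mul]; norm_num
  calc (16 : ℝ) ^ d ≤ Real.exp 3 ^ d := pow_le_pow_left₀ (by norm_num) h d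
    _ = Real.exp (3 * d) := by rw [← Real.exp_nat_mul]; ring_nf

/-- The ranges that take up at least half of `Q` are hit by a set of linear size in the
VC-dimension. -/
theorem exists_half_net [Fintype X] {w : X → ℝ} (hw : ∀ x, 0 ≤ w x)
    {ℛ : Finset (Finset X)} {d : ℕ} (hd : ℛ.vcDim ≤ d) {Q : Finset X} (hQ : 0 < ∑ x ∈ Q, w x) :
    ∃ N : Finset X, (∀ x ∈ N, 0 < w x) ∧ N.card ≤ 24 * d + 1 ∧
      ∀ R ∈ ℛ, (∑ x ∈ Q, w x) / 2 ≤ ∑ x ∈ R ∩ Q, w x → ∃ x ∈ N, x ∈ R := by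
  classical
  set q := ∑ x ∈ Q, w x with hq
  -- Sampling is from `w` conditioned on `Q`, so 24d + 1 points give the exponent 3d - (24d + 1)/8 <
  -- 0.
  set v : X → ℝ := fun x => if x ∈ Q then w x / q else 0 with hv
  have hsum : ∀ R : Finset X, ∑ x ∈ R, v x = (∑ x ∈ R ∩ Q, w x) / q := by
    intro R
    rw [hv, ← sum_filter, filter_mem_eq_inter, sum_div]
  have hv0 : ∀ x, 0 ≤ v x := by
    intro x
    simp only [hv]
    split_ifs
    · exact div_nonneg (hw x) hQ.le
    · exact le_rfl
  have hv1 : ∑ x, v x = 1 := by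
    rw [hsum, univ_inter, ← hq, div_self hQ.ne']
  have hvQ : ∑ x ∈ Q, v x = 1 := by
    rw [hsum, inter_self, ← hq, div_self hQ.ne']
  have h1 := missing_le hv0 hv1 hd Q (24 * d + 1)
  have h2 : (16 : ℝ) ^ d * Real.exp (-((∑ x ∈ Q, v x) * (24 * d + 1 : ℕ) / 8)) < 1 := by
    rw [hvQ]
    calc _ ≤ Real.exp (3 * d) * Real.exp (-(1 * (24 * d + 1 : ℕ) / 8)) :=
          mul_le_mul_of_nonneg_right (sixteen_pow_le_exp d) (Real.exp_pos _).le
      _ < 1 := by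
          rw [← Real.exp_add, Real.exp_lt_one_iff]
          push_cast
          linarith
  have h3 : ∑ f : Fin (24 * d + 1) → X, ∏ i, v (f i) = 1 := by
    rw [sum_prod_tuple, hv1, one_pow]
  obtain ⟨f, _, hf⟩ := exists_lt_of_sum_lt ((h1.trans_lt h2).trans_eq h3.symm)
  have hmiss : ¬ Misses v ℛ Q f := by
    intro h
    rw [if_pos h] at hf
    exact lt_irrefl _ hf
  rw [if_neg hmiss] at hf
  refine ⟨univ.image f, ?_, ?_, ?_⟩
  · intro x hx
    obtain ⟨i, _, rfl⟩ := mem_image.1 hx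
    have h4 := pos_of_prod_pos hv0 hf i
    refine (hw _).lt_of_ne fun h => h4.ne' ?_
    simp [hv, ← h]
  · exact card_image_le.trans (by simp)
  · intro R hR hRQ
    by_contra hno
    refine hmiss ⟨R, hR, ?_, fun i hi => ?_⟩
    · rw [hvQ, hsum, inter_assoc, inter_self, le_div_iff₀ hQ]
      linarith
    · exact hno ⟨f i, mem_image_of_mem _ (mem_univ i), (mem_inter.1 hi).1⟩

/-- If each range takes up at least half of one of at most `D` sets of weight at least `η`, then
the ranges are hit by `O((d + log (η D)) / η)` points. -/
theorem exists_hitting_set [Fintype X] {w : X → ℝ} (hw : ∀ x, 0 ≤ w x) (hw1 : ∑ x, w x = 1)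
    {ℛ 𝒬 : Finset (Finset X)} {d : ℕ} (hd : ℛ.vcDim ≤ d) {η L : ℝ} (hη : 0 < η) (hη1 : η ≤ 1)
    (hL : 1 / 2 ≤ L) (hcard : η * 𝒬.card ≤ Real.exp L) (h𝒬 : ∀ Q ∈ 𝒬, η ≤ ∑ x ∈ Q, w x)
    (hcov : ∀ R ∈ ℛ, ∃ Q ∈ 𝒬, (∑ x ∈ Q, w x) / 2 ≤ ∑ x ∈ R ∩ Q, w x) :
    ∃ S : Finset X, (∀ x ∈ S, 0 < w x) ∧ (∀ R ∈ ℛ, ∃ x ∈ S, x ∈ R) ∧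
      (S.card : ℝ) ≤ 58 * ((d + L) / η) := by
  classical
  -- Of the exponent 4d + L, 3d cancels 16^d, L pays for the number of sets, and the last d pays for
  -- repair nets of size 24d + 1.
  set m := ⌈8 * (4 * d + L) / η⌉₊ with hm
  have hm1 : 8 * (4 * d + L) ≤ η * m := by
    rw [mul_comm η]
    exact (div_le_iff₀ hη).1 (Nat.le_ceil _)
  have hm2 : (m : ℝ) ≤ 8 * (4 * d + L) / η + 1 := (Nat.ceil_lt_add_one (by positivity)).le
  set B : (Fin m → X) → Finset (Finset X) := fun f => {Q ∈ 𝒬 | Misses w ℛ Q f} with hB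
  have hexp : ∑ f : Fin m → X, (∏ i, w (f i)) * ((B f).card : ℝ) ≤ Real.exp (-d) / η := by
    calc ∑ f : Fin m → X, (∏ i, w (f i)) * ((B f).card : ℝ)
        = ∑ Q ∈ 𝒬, ∑ f : Fin m → X, if Misses w ℛ Q f then ∏ i, w (f i) else 0 := by
          rw [sum_comm]
          refine sum_congr rfl fun f _ => ?_
          rw [← sum_filter, sum_const, nsmul_eq_mul, mul_comm]
      _ ≤ ∑ Q ∈ 𝒬, Real.exp (-d - L) := by
          refine sum_le_sum fun Q hQ => (missing_le hw hw1 hd Q m).trans ?_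
          refine (mul_le_mul_of_nonneg_right (sixteen_pow_le_exp d) (Real.exp_pos _).le).trans ?_
          rw [← Real.exp_add, Real.exp_le_exp]
          have := mul_le_mul_of_nonneg_right (h𝒬 Q hQ) (Nat.cast_nonneg (α := ℝ) m)
          linarith
      _ ≤ Real.exp (-d) / η := by
          rw [sum_const, nsmul_eq_mul, le_div_iff₀ hη, Real.exp_sub, mul_div_assoc',
            div_mul_eq_mul_div, div_le_iff₀ (Real.exp_pos _)]
          calc _ = Real.exp (-d) * (η * 𝒬.card) := by ring
            _ ≤ _ := mul_le_mul_of_nonneg_left hcard (Real.exp_pos _).le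
  -- Some sample does no worse than the mean; its positive weight keeps its points in the support.
  obtain ⟨f, hf, hBf⟩ : ∃ f : Fin m → X, 0 < ∏ i, w (f i) ∧
      ((B f).card : ℝ) ≤ Real.exp (-d) / η := by
    by_contra! hcon
    have hprod : ∀ g : Fin m → X, 0 ≤ ∏ i, w (g i) := fun g => prod_nonneg fun i _ => hw _
    have h1 : ∑ f : Fin m → X, ∏ i, w (f i) = 1 := by rw [sum_prod_tuple, hw1, one_pow]
    obtain ⟨f, _, hf⟩ : ∃ f ∈ (univ : Finset (Fin m → X)), (0 : ℝ) < ∏ i, w (f i) := by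
      refine exists_lt_of_sum_lt ?_
      rw [h1, sum_const_zero]
      exact zero_lt_one
    have h2 : ∑ f : Fin m → X, (∏ i, w (f i)) * (Real.exp (-d) / η) <
        ∑ f : Fin m → X, (∏ i, w (f i)) * ((B f).card : ℝ) := by
      refine sum_lt_sum (fun g _ => ?_)
        ⟨f, mem_univ _, mul_lt_mul_of_pos_left (hcon f hf) hf⟩
      rcases (hprod g).eq_or_lt with h | h
      · rw [← h, zero_mul, zero_mul]
      · exact mul_le_mul_of_nonneg_left (hcon g h).le h.le
    rw [← sum_mul, h1, one_mul] at h2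
    exact absurd hexp (not_le.2 h2)
  have hnet : ∀ Q, ∃ N : Finset X, (∀ x ∈ N, 0 < w x) ∧ N.card ≤ 24 * d + 1 ∧
      (Q ∈ 𝒬 → ∀ R ∈ ℛ, (∑ x ∈ Q, w x) / 2 ≤ ∑ x ∈ R ∩ Q, w x → ∃ x ∈ N, x ∈ R) := by
    intro Q
    by_cases hQ : Q ∈ 𝒬
    · obtain ⟨N, h1, h2, h3⟩ := exists_half_net hw hd (hη.trans_le (h𝒬 Q hQ))
      exact ⟨N, h1, h2, fun _ => h3⟩
    · exact ⟨∅, by simp, by simp, fun h => absurd h hQ⟩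
  choose N hN1 hN2 hN3 using hnet
  refine ⟨univ.image f ∪ (B f).biUnion N, ?_, ?_, ?_⟩
  · intro x hx
    rcases mem_union.1 hx with hx | hx
    · obtain ⟨i, _, rfl⟩ := mem_image.1 hx
      exact pos_of_prod_pos hw hf i
    · obtain ⟨Q, _, hxQ⟩ := mem_biUnion.1 hx
      exact hN1 Q x hxQ
  · intro R hR
    obtain ⟨Q, hQ, hRQ⟩ := hcov R hR
    by_cases hmiss : Misses w ℛ Q f
    · obtain ⟨x, hx, hxR⟩ := hN3 Q hQ R hR hRQ
      exact ⟨x, mem_union_right _ (mem_biUnion.2 ⟨Q, mem_filter.2 ⟨hQ, hmiss⟩, hx⟩), hxR⟩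
    · by_contra hno
      exact hmiss ⟨R, hR, hRQ, fun i hi => hno ⟨f i,
        mem_union_left _ (mem_image_of_mem _ (mem_univ i)), (mem_inter.1 hi).1⟩⟩
  · have h1 : (univ.image f ∪ (B f).biUnion N).card ≤ m + (B f).card * (24 * d + 1) := by
      refine (card_union_le _ _).trans (add_le_add (card_image_le.trans (by simp)) ?_)
      exact card_biUnion_le_card_mul _ _ _ fun Q _ => hN2 Q
    have h2 : ((univ.image f ∪ (B f).biUnion N).card : ℝ) ≤ m + (B f).card * (24 * d + 1) := by
      exact_mod_cast h1
    have h3 : Real.exp (-d) * (24 * d + 1) ≤ 24 := by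
      rw [Real.exp_neg, inv_mul_le_iff₀ (Real.exp_pos _)]
      linarith [Real.add_one_le_exp (d : ℝ)]
    have h4 : ((B f).card : ℝ) * (24 * d + 1) ≤ 24 / η := by
      refine (mul_le_mul_of_nonneg_right hBf (by positivity)).trans ?_
      rw [div_mul_eq_mul_div]
      exact div_le_div_of_nonneg_right h3 hη.le
    have h5 : (1 : ℝ) ≤ 1 / η := (one_le_div hη).2 hη1
    calc ((univ.image f ∪ (B f).biUnion N).card : ℝ)
        ≤ 8 * (4 * d + L) / η + 1 / η + 24 / η := by linarith
      _ = (8 * (4 * d + L) + 25) / η := by ring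
      -- The additive 25 is absorbed as 50 L, using L ≥ 1/2.
      _ ≤ (58 * (d + L)) / η := by
          refine div_le_div_of_nonneg_right ?_ hη.le
          have : (0 : ℝ) ≤ d := Nat.cast_nonneg d
          linarith
      _ = 58 * ((d + L) / η) := by ring

end Sampling

/-! ### Dyadic layers, packings and the two bounds -/

section Layers

variable {X : Type*} [MeasurableSpace X]

/-- The ranges of measure between `δ` and `2 δ`. -/
def layer (P : Measure X) (ℛ : Finset (Finset X)) (δ : ℝ) : Finset (Finset X) :=
  {R ∈ ℛ | δ ≤ P.real (R : Set X) ∧ P.real (R : Set X) ≤ 2 * δ}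

theorem layer_subset_lightRanges (P : Measure X) (ℛ : Finset (Finset X)) (δ : ℝ) :
    layer P ℛ δ ⊆ lightRanges P ℛ (2 * δ) := fun _ hR =>
  mem_filter.2 ⟨(mem_filter.1 hR).1, (mem_filter.1 hR).2.2⟩

theorem symmDist_comm (P : Measure X) (A B : Finset X) : symmDist P A B = symmDist P B A := by
  rw [symmDist, symmDist, symmDiff_comm]

theorem IsPacking.card_le {P : Measure X} {δ : ℝ} {ℱ 𝒬 : Finset (Finset X)}
    (h : IsPacking P δ 𝒬) (hsub : 𝒬 ⊆ ℱ) : 𝒬.card ≤ packingNumber P ℱ δ := by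
  classical
  exact le_sup (f := Finset.card) (mem_filter.2 ⟨mem_powerset.2 hsub, h⟩)

theorem packingNumber_le_doublingConstant (P : Measure X) (ℛ : Finset (Finset X)) {ε δ : ℝ}
    (h : ε ≤ δ) : packingNumber P (lightRanges P ℛ (2 * δ)) δ ≤ doublingConstant P ℛ ε :=
  le_ciSup (bddAbove_doublingConstant P ℛ ε) (⟨δ, h⟩ : Set.Ici ε)

theorem one_le_capacity (P : Measure X) (ℛ : Finset (Finset X)) (ε : ℝ) :
    1 ≤ capacity P ℛ ε := le_max_left _ _

theorem measureReal_le_capacity_mul (P : Measure X) [IsProbabilityMeasure P]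
    (ℛ : Finset (Finset X)) {ε δ : ℝ} (hε : 0 < ε) (h : ε ≤ δ) :
    P.real (⋃ R ∈ lightRanges P ℛ δ, (R : Set X)) ≤ capacity P ℛ ε * δ := by
  rw [← div_le_iff₀ (hε.trans_le h)]
  exact (le_ciSup (bddAbove_capacity P ℛ hε) (⟨δ, h⟩ : Set.Ici ε)).trans (le_max_right _ _)

/-- A maximal packing: every other member of the family is close to one of its members. -/
theorem exists_maximal_packing (P : Measure X) (ℱ : Finset (Finset X)) (δ : ℝ) :
    ∃ 𝒬 ⊆ ℱ, IsPacking P δ 𝒬 ∧ ∀ R ∈ ℱ, R ∉ 𝒬 → ∃ Q ∈ 𝒬, symmDist P R Q < δ := by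
  classical
  obtain ⟨𝒬, h𝒬, hmax⟩ := exists_max_image {𝒬 ∈ ℱ.powerset | IsPacking P δ 𝒬} Finset.card
    ⟨∅, mem_filter.2 ⟨empty_mem_powerset _, fun A hA => absurd hA (notMem_empty A)⟩⟩
  obtain ⟨hsub, hpack⟩ := mem_filter.1 h𝒬
  rw [mem_powerset] at hsub
  refine ⟨𝒬, hsub, hpack, fun R hR hR𝒬 => ?_⟩
  by_contra! hfar
  have hins : IsPacking P δ (insert R 𝒬) := by
    intro A hA B hB hAB
    rcases mem_insert.1 hA with rfl | hA' <;> rcases mem_insert.1 hB with rfl | hB'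
    · exact absurd rfl hAB
    · exact hfar B hB'
    · rw [symmDist_comm]
      exact hfar A hA'
    · exact hpack A hA' B hB' hAB
  have h1 := hmax (insert R 𝒬)
    (mem_filter.2 ⟨mem_powerset.2 (insert_subset hR hsub), hins⟩)
  rw [card_insert_of_notMem hR𝒬] at h1
  omega

theorem exists_dyadic_scale {ε a : ℝ} (ha : ε ≤ a) (n : ℕ) (hn : a < 2 ^ n * ε) :
    ∃ i < n, 2 ^ i * ε ≤ a ∧ a ≤ 2 * (2 ^ i * ε) := by
  induction n with
  | zero => simp at hn; linarith
  | succ k ih =>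
    by_cases hk : a < 2 ^ k * ε
    · obtain ⟨i, hi, h⟩ := ih hk
      exact ⟨i, hi.trans k.lt_succ_self, h⟩
    · refine ⟨k, k.lt_succ_self, not_lt.1 hk, ?_⟩
      rw [pow_succ] at hn
      linarith

theorem exists_isNet_of_layers [DecidableEq X] (P : Measure X) [IsProbabilityMeasure P]
    {ℛ : Finset (Finset X)} {ε : ℝ} {n : ℕ} (hn : 1 < 2 ^ n * ε) (b : ℕ → ℝ)
    (h : ∀ i, ∃ S : Finset X, (∀ x ∈ S, 0 < P.real {x}) ∧
      (∀ R ∈ layer P ℛ (2 ^ i * ε), ∃ x ∈ S, x ∈ R) ∧ (S.card : ℝ) ≤ b i) :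
    ∃ S : Finset X, IsNet P ℛ ε S ∧ (S.card : ℝ) ≤ ∑ i ∈ range n, b i := by
  choose S hS1 hS2 hS3 using h
  refine ⟨(range n).biUnion S, ⟨fun x hx => ?_, fun R hR hεR => ?_⟩, ?_⟩
  · obtain ⟨i, _, hx⟩ := mem_biUnion.1 hx
    exact hS1 i x hx
  · obtain ⟨i, hi, h1, h2⟩ := exists_dyadic_scale hεR n (measureReal_le_one.trans_lt hn)
    obtain ⟨x, hx, hxR⟩ := hS2 i R (mem_filter.2 ⟨hR, h1, h2⟩)
    exact ⟨x, mem_biUnion.2 ⟨i, mem_range.2 hi, hx⟩, hxR⟩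
  · refine le_trans ?_ (sum_le_sum fun i _ => hS3 i)
    exact_mod_cast card_biUnion_le

theorem sum_add_div_two_pow_le (a : ℝ) (ha : 0 ≤ a) (n : ℕ) :
    ∑ i ∈ range n, (a + i) / 2 ^ i ≤ 2 * a + 2 := by
  have h : ∑ i ∈ range n, (a + i) / 2 ^ i = 2 * a + 2 - (2 * a + 2 * n + 2) / 2 ^ n := by
    induction n with
    | zero => simp
    | succ k ih =>
      rw [sum_range_succ, ih, pow_succ]
      push_cast
      field_simp
      ring
  rw [h]
  linarith [show 0 ≤ (2 * a + 2 * n + 2) / 2 ^ n by positivity]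

theorem exists_dyadic_count {ε : ℝ} (hε : 0 < ε) :
    ∃ n : ℕ, 1 < 2 ^ n * ε ∧ (n : ℝ) ≤ 3 * max 1 (Real.log (1 / ε)) := by
  set M := max 1 (Real.log (1 / ε)) with hM
  have hM1 : 1 ≤ M := le_max_left _ _
  have hM0 : 0 ≤ 2 * M := by linarith
  refine ⟨⌊2 * M⌋₊ + 1, ?_, ?_⟩
  · rw [← div_lt_iff₀ hε]
    calc 1 / ε = Real.exp (Real.log (1 / ε)) := (Real.exp_log (by positivity)).symm
      _ ≤ Real.exp M := Real.exp_le_exp.2 (le_max_right _ _)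
      -- Since log 2 ≥ 1/2, more than 2M doublings exceed e^M.
      _ < Real.exp (Real.log 2 * (⌊2 * M⌋₊ + 1 : ℕ)) := by
          rw [Real.exp_lt_exp]
          have h1 := Nat.lt_floor_add_one (2 * M)
          have h2 : (1 / 2 : ℝ) ≤ Real.log 2 := by linarith [Real.log_two_gt_d9]
          push_cast
          nlinarith
      _ = 2 ^ (⌊2 * M⌋₊ + 1) := by
          rw [mul_comm, Real.exp_nat_mul, Real.exp_log two_pos]
  · push_cast
    linarith [Nat.floor_le hM0]

variable [DecidableEq X] [MeasurableSingletonClass X]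

theorem symmDist_eq (P : Measure X) [IsFiniteMeasure P] (A B : Finset X) :
    symmDist P A B =
      P.real (A : Set X) + P.real (B : Set X) - 2 * P.real ((A ∩ B : Finset X) : Set X) := by
  have hA := measureReal_inter_add_sdiff (μ := P) (s := (A : Set X)) B.measurableSet
  have hB := measureReal_inter_add_sdiff (μ := P) (s := (B : Set X)) A.measurableSet
  rw [Set.inter_comm] at hB
  have hAB : symmDist P A B = P.real ((A : Set X) \ B) + P.real ((B : Set X) \ A) := by
    rw [symmDist, Set.symmDiff_def, measureReal_union disjoint_sdiff_sdiff
      (B.measurableSet.diff A.measurableSet)]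
  rw [coe_inter]
  linarith

/-- If P(R ∆ Q) < δ ≤ P(R), then P(R) + P(Q) - 2P(R ∩ Q) < P(R), so R fills more than half of Q. -/
theorem exists_layer_cover (P : Measure X) [IsFiniteMeasure P] (ℛ : Finset (Finset X)) (δ : ℝ) :
    ∃ 𝒬 ⊆ layer P ℛ δ, 𝒬.card ≤ packingNumber P (lightRanges P ℛ (2 * δ)) δ ∧
      ∀ R ∈ layer P ℛ δ, ∃ Q ∈ 𝒬,
        P.real (Q : Set X) / 2 ≤ P.real ((R ∩ Q : Finset X) : Set X) := by
  obtain ⟨𝒬, hsub, hpack, hmax⟩ := exists_maximal_packing P (layer P ℛ δ) δ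
  refine ⟨𝒬, hsub, hpack.card_le (hsub.trans (layer_subset_lightRanges P ℛ δ)), fun R hR => ?_⟩
  by_cases hR𝒬 : R ∈ 𝒬
  · refine ⟨R, hR𝒬, ?_⟩
    rw [inter_self]
    linarith [measureReal_nonneg (μ := P) (s := (R : Set X))]
  · obtain ⟨Q, hQ, hRQ⟩ := hmax R hR hR𝒬
    refine ⟨Q, hQ, ?_⟩
    rw [symmDist_eq] at hRQ
    linarith [(mem_filter.1 hR).2.1]

variable [Fintype X]

/-- A hitting set for one layer, obtained by sampling from a set `U` containing its ranges. -/
theorem exists_layer_hitting_set (P : Measure X) [IsFiniteMeasure P] {ℛ : Finset (Finset X)}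
    {d : ℕ} (hd : ℛ.vcDim ≤ d) {δ η L : ℝ} (hδ : 0 < δ) (hη : 0 < η) (hL : 1 / 2 ≤ L)
    {U : Finset X} (hU : ∀ R ∈ layer P ℛ δ, R ⊆ U) (hPU : η * P.real (U : Set X) ≤ δ)
    (hcard : η * packingNumber P (lightRanges P ℛ (2 * δ)) δ ≤ Real.exp L) :
    ∃ S : Finset X, (∀ x ∈ S, 0 < P.real {x}) ∧ (∀ R ∈ layer P ℛ δ, ∃ x ∈ S, x ∈ R) ∧
      (S.card : ℝ) ≤ 58 * ((d + L) / η) := by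
  -- A nonempty layer makes P(U) positive and forces η ≤ 1, as ηP(U) ≤ δ ≤ P(U).
  rcases (layer P ℛ δ).eq_empty_or_nonempty with he | ⟨R₀, hR₀⟩
  · refine ⟨∅, by simp, by simp [he], ?_⟩
    rw [card_empty, Nat.cast_zero]
    positivity
  have hδU : δ ≤ P.real (U : Set X) :=
    (mem_filter.1 hR₀).2.1.trans (measureReal_mono (coe_subset.2 (hU R₀ hR₀)))
  set u := P.real (U : Set X) with hu
  have hu0 : 0 < u := hδ.trans_le hδU
  have hη1 : η ≤ 1 := by
    refine le_of_mul_le_mul_right ?_ hu0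
    linarith
  set w : X → ℝ := fun x => if x ∈ U then P.real {x} / u else 0 with hw
  have hsum : ∀ R ⊆ U, ∑ x ∈ R, w x = P.real (R : Set X) / u := by
    intro R hR
    rw [hw, sum_congr rfl fun x hx => if_pos (hR hx), ← sum_div, sum_measureReal_singleton]
  have hw0 : ∀ x, 0 ≤ w x := by
    intro x
    simp only [hw]
    split_ifs
    · positivity
    · exact le_rfl
  have hw1 : ∑ x, w x = 1 := by
    rw [← sum_subset (subset_univ U) fun x _ hx => if_neg hx, hsum U Subset.rfl, div_self hu0.ne']
  obtain ⟨𝒬, hsub, h𝒬card, hcov⟩ := exists_layer_cover P ℛ δ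
  have h𝒬U : ∀ Q ∈ 𝒬, Q ⊆ U := fun Q hQ => hU Q (hsub hQ)
  obtain ⟨S, hS1, hS2, hS3⟩ := exists_hitting_set hw0 hw1 (ℛ := layer P ℛ δ) (𝒬 := 𝒬)
    ((vcDim_mono (filter_subset _ _)).trans hd) hη hη1 hL
    ((mul_le_mul_of_nonneg_left (Nat.cast_le.2 h𝒬card) hη.le).trans hcard)
    (by
      intro Q hQ
      rw [hsum Q (h𝒬U Q hQ), le_div_iff₀ hu0]
      exact hPU.trans (mem_filter.1 (hsub hQ)).2.1)
    (by
      intro R hR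
      obtain ⟨Q, hQ, hRQ⟩ := hcov R hR
      refine ⟨Q, hQ, ?_⟩
      rw [hsum Q (h𝒬U Q hQ), hsum _ (inter_subset_left.trans (hU R hR)), div_right_comm]
      exact div_le_div_of_nonneg_right hRQ hu0.le)
  refine ⟨S, fun x hx => ?_, hS2, hS3⟩
  have h := hS1 x hx
  simp only [hw] at h
  split_ifs at h
  · exact (div_pos_iff_of_pos_right hu0).1 h
  · exact absurd h (lt_irrefl 0)

/-- With η = 2^i ε the product ηD doubles from layer to layer, so L = log(εD) + i; the extra i is
absorbed by the geometric decay of 1/η. -/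
theorem exists_isNet_of_doubling (P : Measure X) [IsProbabilityMeasure P]
    {ℛ : Finset (Finset X)} {d : ℕ} (hd : ℛ.vcDim ≤ d) {ε D : ℝ} (hε : 0 < ε)
    (hD : (doublingConstant P ℛ ε : ℝ) ≤ D) (hDε : Real.exp 1 / ε ≤ D) :
    ∃ S : Finset X, IsNet P ℛ ε S ∧
      (S.card : ℝ) ≤ 232 * (1 / ε * (d + Real.log (ε * D))) := by
  obtain ⟨n, hn, _⟩ := exists_dyadic_count hε
  have hεD : Real.exp 1 ≤ ε * D := by
    rw [mul_comm]
    exact (div_le_iff₀ hε).1 hDε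
  have hεD0 : 0 < ε * D := (Real.exp_pos 1).trans_le hεD
  have hlog : 1 ≤ Real.log (ε * D) := (Real.le_log_iff_exp_le hεD0).2 hεD
  have hd0 : (0 : ℝ) ≤ d := Nat.cast_nonneg d
  obtain ⟨S, hS, hcard⟩ := exists_isNet_of_layers P (ℛ := ℛ) hn
    (fun i => 58 * ((d + (Real.log (ε * D) + i)) / (2 ^ i * ε))) (by
      intro i
      have hi : ε ≤ 2 ^ i * ε := le_mul_of_one_le_left hε.le (one_le_pow₀ one_le_two)
      have hi0 : (0 : ℝ) ≤ i := Nat.cast_nonneg i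
      refine exists_layer_hitting_set P hd (U := univ) (by positivity) (by positivity)
        (by linarith) (fun R _ => subset_univ R) ?_ ?_
      · exact mul_le_of_le_one_right (by positivity) measureReal_le_one
      · rw [Real.exp_add, Real.exp_log hεD0]
        have h1 : (packingNumber P (lightRanges P ℛ (2 * (2 ^ i * ε))) (2 ^ i * ε) : ℝ) ≤ D :=
          (Nat.cast_le.2 (packingNumber_le_doublingConstant P ℛ hi)).trans hD
        have h2 : (2 : ℝ) ^ i ≤ Real.exp i := by
          rw [← mul_one (i : ℝ), Real.exp_nat_mul]
          exact pow_le_pow_left₀ two_pos.le (by linarith [Real.exp_one_gt_d9]) i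
        calc _ ≤ 2 ^ i * ε * D := mul_le_mul_of_nonneg_left h1 (by positivity)
          _ = ε * D * 2 ^ i := by ring
          _ ≤ ε * D * Real.exp i := mul_le_mul_of_nonneg_left h2 hεD0.le)
  refine ⟨S, hS, hcard.trans ?_⟩
  calc ∑ i ∈ range n, 58 * ((d + (Real.log (ε * D) + i)) / (2 ^ i * ε))
      = 58 / ε * ∑ i ∈ range n, (d + Real.log (ε * D) + i) / 2 ^ i := by
        rw [mul_sum]
        refine sum_congr rfl fun i _ => ?_
        field_simp
        ring
    _ ≤ 58 / ε * (2 * (d + Real.log (ε * D)) + 2) :=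
        mul_le_mul_of_nonneg_left (sum_add_div_two_pow_le _ (by linarith) n) (by positivity)
    _ ≤ 58 / ε * (4 * (d + Real.log (ε * D))) :=
        mul_le_mul_of_nonneg_left (by linarith) (by positivity)
    _ = 232 * (1 / ε * (d + Real.log (ε * D))) := by ring

/-- By the definition of capacity, the ranges of measure at most 2δ cover measure at most 2τδ, so η
= 1/(2τ) works in every layer, and the last factor counts layers. -/
theorem exists_isNet_of_capacity (P : Measure X) [IsProbabilityMeasure P]
    {ℛ : Finset (Finset X)} {d : ℕ} (hd : ℛ.vcDim ≤ d) {ε D : ℝ} (hε : 0 < ε)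
    (hD : (doublingConstant P ℛ ε : ℝ) ≤ D) (hDτ : 2 * capacity P ℛ ε ≤ D) :
    ∃ S : Finset X, IsNet P ℛ ε S ∧
      (S.card : ℝ) ≤ 348 * (capacity P ℛ ε * (d + Real.log (D / capacity P ℛ ε)) *
        max 1 (Real.log (1 / ε))) := by
  obtain ⟨n, hn, hn'⟩ := exists_dyadic_count hε
  set τ := capacity P ℛ ε with hτ
  have hτ0 : 0 < τ := zero_lt_one.trans_le (one_le_capacity P ℛ ε)
  have hDτ2 : 2 ≤ D / τ := (le_div_iff₀ hτ0).2 hDτ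
  have hlog : 1 / 2 ≤ Real.log (D / τ) := by
    linarith [Real.log_two_gt_d9, Real.log_le_log two_pos hDτ2]
  obtain ⟨S, hS, hcard⟩ := exists_isNet_of_layers P (ℛ := ℛ) hn
    (fun _ => 58 * ((d + Real.log (D / τ)) / (1 / (2 * τ)))) (by
      intro i
      have hi : ε ≤ 2 ^ i * ε := le_mul_of_one_le_left hε.le (one_le_pow₀ one_le_two)
      refine exists_layer_hitting_set P hd (U := (lightRanges P ℛ (2 * (2 ^ i * ε))).biUnion id)
        (by positivity) (by positivity) hlog
        (fun R hR => subset_biUnion_of_mem id (layer_subset_lightRanges P ℛ _ hR)) ?_ ?_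
      · have h := measureReal_le_capacity_mul P ℛ (δ := 2 * (2 ^ i * ε)) hε (by linarith)
        rw [coe_biUnion, one_div, inv_mul_le_iff₀ (by positivity)]
        simp only [id, mem_coe]
        linarith
      · have h1 : (packingNumber P (lightRanges P ℛ (2 * (2 ^ i * ε))) (2 ^ i * ε) : ℝ) ≤ D :=
          (Nat.cast_le.2 (packingNumber_le_doublingConstant P ℛ hi)).trans hD
        rw [Real.exp_log (by linarith), one_div, inv_mul_le_iff₀ (by positivity)]
        have h2 : 2 * τ * (D / τ) = 2 * D := by field_simp
        linarith)
  refine ⟨S, hS, hcard.trans ?_⟩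
  have hd0 : (0 : ℝ) ≤ d := Nat.cast_nonneg d
  rw [sum_const, card_range, nsmul_eq_mul]
  calc (n : ℝ) * (58 * ((d + Real.log (D / τ)) / (1 / (2 * τ))))
      = n * (116 * (τ * (d + Real.log (D / τ)))) := by rw [div_div_eq_mul_div, div_one]; ring
    _ ≤ 3 * max 1 (Real.log (1 / ε)) * (116 * (τ * (d + Real.log (D / τ)))) :=
        mul_le_mul_of_nonneg_right hn'
          (mul_nonneg (by norm_num) (mul_nonneg hτ0.le (by linarith)))
    _ = _ := by ring

end Layers

end RangeSpace

end

theorem corollary5 :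
    ∃ C : ℝ, 0 < C ∧
      ∀ (X : Type*) [Fintype X] [DecidableEq X] [MeasurableSpace X] [MeasurableSingletonClass X]
        (P : MeasureTheory.Measure X) [MeasureTheory.IsProbabilityMeasure P]
        (ℛ : Finset (Finset X)) (d : ℕ) (ε D : ℝ),
        ℛ.vcDim = d → 0 < ε → (RangeSpace.doublingConstant P ℛ ε : ℝ) ≤ D →
        (Real.exp 1 / ε ≤ D →
          ∃ S : Finset X, RangeSpace.IsNet P ℛ ε S ∧
            (S.card : ℝ) ≤ C * (1 / ε * (d + Real.log (ε * D)))) ∧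
        (2 * RangeSpace.capacity P ℛ ε ≤ D →
          ∃ S : Finset X, RangeSpace.IsNet P ℛ ε S ∧
            (S.card : ℝ) ≤ C * (RangeSpace.capacity P ℛ ε *
              (d + Real.log (D / RangeSpace.capacity P ℛ ε)) *
              max 1 (Real.log (1 / ε)))) := by
  -- 348 = 3 · 2 · 58 comes from the second bound and exceeds the 232 = 4 · 58 of the first.
  refine ⟨348, by norm_num, fun X _ _ _ _ P _ ℛ d ε D hd hε hD => ⟨fun hDε => ?_, fun hDτ =>
    RangeSpace.exists_isNet_of_capacity P hd.le hε hD hDτ⟩⟩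
  obtain ⟨S, hS, hcard⟩ := RangeSpace.exists_isNet_of_doubling P hd.le hε hD hDε
  refine ⟨S, hS, hcard.trans (mul_le_mul_of_nonneg_right (by norm_num) ?_)⟩
  -- The bracket is nonnegative because a multiple of it bounds a cardinality.
  have h232 : 0 ≤ 232 * (1 / ε * (d + Real.log (ε * D))) := (Nat.cast_nonneg _).trans hcard
  linarith
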